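/- Let $D$ be a discrete valuation ring with field of fractions $F$, uniformizing parameter $\pi$ and residue field $K=D/(\pi)$. Let $\mathcal O\subseteq M_n(F)$ be a tiled classical $D$-order, that is, a $D$-subalgebra of $M_n(F)$ which is finitely generated as a $D$-module, spans $M_n(F)$ over $F$, and contains a complete set of $n$ nonzero orthogonal idempotents (i.e. nonzero $e_1,\dots,e_n\in\mathcal O$ with $e_ie_j=0$ for $i\ne j$, $e_i^2=e_i$ and $e_1+\dots+e_n=1$). Then the $K$-algebra $\Lambda=\mathcal O/\pi\mathcal O$ is finite dimensional and has finite uniserial type: there are only finitely many isomorphism classes of uniserial left $\Lambda$-modules, where a module is uniserial if its submodules are totally ordered by inclusion. -/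

import Mathlib

open CategoryTheory

universe w

/-- A module is uniserial if its submodules are totally ordered by inclusion. -/
def IsUniserialModule (R M : Type*) [Ring R] [AddCommGroup M] [Module R M] : Prop :=
  ∀ N P : Submodule R M, N ≤ P ∨ P ≤ N

/-- A ring has finite uniserial type if there are only finitely many isomorphism classes of
uniserial left modules over it. The modules range over a universe `w` and are not required
to be finitely generated. -/
def HasFiniteUniserialType (R : Type*) [Ring R] : Prop :=
  {c : Quotient (isIsomorphicSetoid (ModuleCat.{w} R)) |
    ∃ M : ModuleCat.{w} R, IsUniserialModule R M ∧
      Quotient.mk (isIsomorphicSetoid (ModuleCat.{w} R)) M = c}.Finite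

/-- A `D`-subalgebra `O` of `M_n(F)` is a tiled classical `D`-order if it is finitely generated
as a `D`-module, spans `M_n(F)` over `F`, and contains a complete set of `n` nonzero orthogonal
idempotents. -/
structure IsTiledClassicalOrder {D F : Type*} [CommRing D] [Field F] [Algebra D F] {n : ℕ}
    (O : Subalgebra D (Matrix (Fin n) (Fin n) F)) : Prop where
  finite : Module.Finite D O
  span_eq_top : Submodule.span F (O : Set (Matrix (Fin n) (Fin n) F)) = ⊤
  exists_idempotents : ∃ e : Fin n → O, CompleteOrthogonalIdempotents e ∧ ∀ i, e i ≠ 0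

/-- The ideal `πA` of a (not necessarily commutative) `D`-algebra `A`, for `π ∈ D`. -/
abbrev centralIdeal {D : Type*} (A : Type*) [CommRing D] [Ring A] [Algebra D A] (π : D) :
    Ideal A :=
  Ideal.span {algebraMap D A π}

theorem mem_centralIdeal {D A : Type*} [CommRing D] [Ring A] [Algebra D A] {π : D} {a : A} :
    a ∈ centralIdeal A π ↔ ∃ b : A, a = π • b := by
  rw [Ideal.mem_span_singleton']
  constructor
  · rintro ⟨b, rfl⟩
    exact ⟨b, by rw [Algebra.smul_def, Algebra.commutes]⟩
  · rintro ⟨b, rfl⟩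
    exact ⟨b, by rw [Algebra.smul_def, Algebra.commutes]⟩

instance centralIdeal_isTwoSided {D A : Type*} [CommRing D] [Ring A] [Algebra D A] (π : D) :
    (centralIdeal A π).IsTwoSided where
  mul_mem_of_left b ha := by
    obtain ⟨c, rfl⟩ := mem_centralIdeal.1 ha
    exact mem_centralIdeal.2 ⟨c * b, by rw [smul_mul_assoc]⟩

/-- The quotient ring `A/πA`. -/
abbrev Reduction {D : Type*} (A : Type*) [CommRing D] [Ring A] [Algebra D A] (π : D) : Type _ :=
  A ⧸ centralIdeal A π

/-- `A/πA` as an algebra over `D/(π)`. -/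
instance Reduction.algebra {D A : Type*} [CommRing D] [Ring A] [Algebra D A] (π : D) :
    Algebra (D ⧸ Ideal.span {π}) (Reduction A π) :=
  Ideal.Quotient.algebraQuotientOfLEComap (by
    rw [Ideal.span_singleton_le_iff_mem, Ideal.mem_comap]
    exact Ideal.mem_span_singleton_self _)

/-- Nonzero pairwise orthogonal idempotent endomorphisms, as many as the dimension, have
one-dimensional Peirce components. -/
theorem exists_smul_eq_peirce {F V : Type*} [Field F] [AddCommGroup V] [Module F V]
    [FiniteDimensional F V] {ι : Type*} [Fintype ι] {e : ι → Module.End F V}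
    (he : OrthogonalIdempotents e) (h0 : ∀ i, e i ≠ 0)
    (hcard : Fintype.card ι = Module.finrank F V) (k i : ι) (A B : Module.End F V)
    (hA : e k * A * e i ≠ 0) : ∃ c : F, e k * B * e i = c • (e k * A * e i) := by
  classical
  have hv : ∀ j, ∃ v, v ≠ 0 ∧ e j v = v := fun j => by
    obtain ⟨x, hx⟩ : ∃ x, e j x ≠ 0 := by
      by_contra! h
      exact h0 j (LinearMap.ext h)
    exact ⟨e j x, hx, by rw [← Module.End.mul_apply, he.idem j]⟩
  choose v hv0 hv using hv
  have hev : ∀ i j, i ≠ j → e i (v j) = 0 := fun i j hij => by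
    rw [← hv j, ← Module.End.mul_apply, he.ortho hij, LinearMap.zero_apply]
  have hcoord : ∀ (g : ι → F) (j : ι), e j (∑ l, g l • v l) = g j • v j := fun g j => by
    rw [map_sum, Finset.sum_eq_single j]
    · rw [map_smul, hv]
    · intro l _ hl
      rw [map_smul, hev j l hl.symm, smul_zero]
    · simp
  have hli : LinearIndependent F v := by
    rw [Fintype.linearIndependent_iff]
    intro g hg j
    have h := hcoord g j
    rw [hg, map_zero] at h
    exact (smul_eq_zero.1 h.symm).resolve_right (hv0 j)
  have : Nonempty ι := ⟨k⟩
  let b := basisOfLinearIndependentOfCardEqFinrank hli hcard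
  have hb : ⇑b = v := coe_basisOfLinearIndependentOfCardEqFinrank hli hcard
  have hline : ∀ x, ∃ c : F, e k x = c • v k := fun x => by
    refine ⟨b.repr x k, ?_⟩
    conv_lhs => rw [← b.sum_repr x, hb]
    exact hcoord _ _
  have hother : ∀ (C : Module.End F V) j, j ≠ i → (e k * C * e i) (v j) = 0 := fun C j hj => by
    rw [Module.End.mul_apply, hev i j hj.symm, map_zero]
  have hself : ∀ C : Module.End F V, ∃ c : F, (e k * C * e i) (v i) = c • v k := fun C => by
    rw [Module.End.mul_apply, Module.End.mul_apply]
    exact hline _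
  obtain ⟨a, ha⟩ := hself A
  obtain ⟨c, hc⟩ := hself B
  have ha0 : a ≠ 0 := by
    rintro rfl
    refine hA (b.ext fun j => ?_)
    rw [hb, LinearMap.zero_apply]
    by_cases hj : j = i
    · rw [hj, ha, zero_smul]
    · exact hother A j hj
  refine ⟨c / a, b.ext fun j => ?_⟩
  rw [hb, LinearMap.smul_apply]
  by_cases hj : j = i
  · rw [hj, ha, hc, smul_smul, div_mul_cancel₀ _ ha0]
  · rw [hother A j hj, hother B j hj, smul_zero]

/-- The matrix form of `exists_smul_eq_peirce`. -/
theorem Matrix.exists_smul_eq_peirce {F : Type*} [Field F] {ι : Type*} [Fintype ι]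
    [DecidableEq ι] {e : ι → Matrix ι ι F} (he : OrthogonalIdempotents e) (h0 : ∀ i, e i ≠ 0)
    (k i : ι) (A B : Matrix ι ι F) (hA : e k * A * e i ≠ 0) :
    ∃ c : F, e k * B * e i = c • (e k * A * e i) := by
  let φ : Matrix ι ι F ≃ₐ[F] Module.End F (ι → F) := Matrix.toLinAlgEquiv'
  have hφ : Function.Injective φ := φ.injective
  obtain ⟨c, hc⟩ := _root_.exists_smul_eq_peirce (e := φ ∘ e) (he.map φ.toRingEquiv.toRingHom)
    (fun i => (map_ne_zero_iff φ hφ).2 (h0 i)) (by simp) k i (φ A) (φ B)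
    (by simpa only [Function.comp_apply, ← map_mul] using (map_ne_zero_iff φ hφ).2 hA)
  exact ⟨c, hφ (by simpa only [Function.comp_apply, ← map_mul, ← map_smul] using hc)⟩

/-- In the reduction of an order in `M_n(F)` containing `n` nonzero orthogonal idempotents, every
nonzero element of a Peirce component generates that component. -/
theorem Reduction.exists_mul_eq_peirce {D F : Type*} [CommRing D] [IsDomain D]
    [IsDiscreteValuationRing D] [Field F] [Algebra D F] [IsFractionRing D F]
    {π : D} (hπ : Irreducible π) {n : ℕ} {O : Subalgebra D (Matrix (Fin n) (Fin n) F)}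
    {e : Fin n → O} (he : OrthogonalIdempotents e) (h0 : ∀ i, e i ≠ 0) (k i : Fin n)
    (y z : Reduction O π)
    (hy : Ideal.Quotient.mk (centralIdeal O π) (e k) * y *
      Ideal.Quotient.mk (centralIdeal O π) (e i) ≠ 0) :
    ∃ r, Ideal.Quotient.mk (centralIdeal O π) (e k) * z *
        Ideal.Quotient.mk (centralIdeal O π) (e i) =
      r * (Ideal.Quotient.mk (centralIdeal O π) (e k) * y *
        Ideal.Quotient.mk (centralIdeal O π) (e i)) := by
  obtain ⟨y, rfl⟩ := Ideal.Quotient.mk_surjective y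
  obtain ⟨z, rfl⟩ := Ideal.Quotient.mk_surjective z
  rw [← map_mul, ← map_mul, Ne, Ideal.Quotient.eq_zero_iff_mem] at hy
  have hu : e k * y * e i ≠ 0 := fun h => hy (h ▸ zero_mem _)
  obtain ⟨c, hc⟩ := Matrix.exists_smul_eq_peirce (e := fun j => (e j : Matrix (Fin n) (Fin n) F))
    (he.map O.val.toRingHom) (fun j h => h0 j (Subtype.ext h)) k i y z
    (fun h => hu (Subtype.ext h))
  suffices h : ∃ d : D, e k * z * e i = d • (e k * y * e i) by
    obtain ⟨d, hd⟩ := h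
    refine ⟨Ideal.Quotient.mk _ (algebraMap D O d), ?_⟩
    simp only [← map_mul]
    rw [hd, Algebra.smul_def]
  obtain ⟨d, hd⟩ | ⟨d, hd⟩ := ValuationRing.isInteger_or_isInteger D c
  · exact ⟨d, Subtype.ext (by simpa [← hd] using hc)⟩
  · by_cases hc0 : c = 0
    · exact ⟨0, Subtype.ext (by simpa [hc0] using hc)⟩
    have hvu : e k * y * e i = d • (e k * z * e i) := by
      refine Subtype.ext ?_
      have : (e k * y * e i : Matrix (Fin n) (Fin n) F) = c⁻¹ • (e k * z * e i) := by
        rw [hc, smul_smul, inv_mul_cancel₀ hc0, one_smul]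
      simpa [← hd] using this
    by_cases hdu : IsUnit d
    · obtain ⟨d', hd'⟩ := hdu.exists_left_inv
      exact ⟨d', by rw [hvu, smul_smul, hd', one_smul]⟩
    · have hmem : d ∈ IsLocalRing.maximalIdeal D := hdu
      rw [hπ.maximalIdeal_eq, Ideal.mem_span_singleton'] at hmem
      obtain ⟨d', rfl⟩ := hmem
      exact absurd (mem_centralIdeal.2 ⟨d' • (e k * z * e i), by
        rw [hvu, smul_smul, mul_comm]⟩) hy

/-- If every nonzero element of a Peirce component `e k * R * e i` generates it, then only finitely
many left ideals contain `1 - e i`. -/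
theorem finite_setOf_one_sub_mem {R ι : Type*} [Ring R] [Fintype ι] {e : ι → R}
    (he : CompleteOrthogonalIdempotents e) (i : ι)
    (hR : ∀ k y z, e k * y * e i ≠ 0 → ∃ r, e k * z * e i = r * (e k * y * e i)) :
    {I : Ideal R | 1 - e i ∈ I}.Finite := by
  have key : ∀ I J : Ideal R, 1 - e i ∈ I → 1 - e i ∈ J →
      {k | ∀ z, e k * z * e i ∈ I} = {k | ∀ z, e k * z * e i ∈ J} → I ≤ J := by
    intro I J hI hJ hIJ x hx
    have hxe : x * e i ∈ I := by
      have : x * e i = x - x * (1 - e i) := by rw [mul_sub, mul_one, sub_sub_cancel]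
      rw [this]
      exact I.sub_mem hx (I.mul_mem_left _ hI)
    have hk : ∀ k, e k * x * e i ∈ J := fun k => by
      by_cases h : e k * x * e i = 0
      · exact h ▸ J.zero_mem
      · have hkI : k ∈ {k | ∀ z, e k * z * e i ∈ I} := fun z => by
          obtain ⟨r, hr⟩ := hR k x z h
          rw [hr, mul_assoc (e k)]
          exact I.mul_mem_left _ (I.mul_mem_left _ hxe)
        rw [hIJ] at hkI
        exact hkI x
    have hsum : x = ∑ k, e k * x * e i + x * (1 - e i) := by
      rw [← Finset.sum_mul, ← Finset.sum_mul, he.complete, one_mul, mul_sub, mul_one,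
        add_sub_cancel]
    rw [hsum]
    exact J.add_mem (J.sum_mem fun k _ => hk k) (J.mul_mem_left _ hJ)
  refine Set.Finite.of_finite_image (f := fun I : Ideal R => {k | ∀ z, e k * z * e i ∈ I})
    (Set.toFinite _) fun I hI J hJ hIJ => ?_
  exact le_antisymm (key I J hI hJ hIJ) (key J I hJ hI hIJ.symm)

/-- A nonzero uniserial module over a left Artinian ring with a complete system of idempotents `e`
is generated by an element fixed by some `e i`. -/
theorem IsUniserialModule.exists_span_singleton_eq_top {R M ι : Type*} [Ring R]
    [IsArtinianRing R] [AddCommGroup M] [Module R M] [Fintype ι] {e : ι → R}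
    (he : CompleteOrthogonalIdempotents e) (hM : IsUniserialModule R M) [Nontrivial M] :
    ∃ (i : ι) (x : M), e i • x = x ∧ Submodule.span R {x} = ⊤ := by
  have hne : ∃ p : ι × M, e p.1 • p.2 = p.2 := by
    obtain ⟨i, -⟩ : ∃ i : ι, True := by
      by_contra! h
      have : IsEmpty ι := ⟨fun i => h i⟩
      have h1 : (1 : R) = 0 := by rw [← he.complete]; simp
      obtain ⟨x, hx⟩ := exists_ne (0 : M)
      exact hx (by rw [← one_smul R x, h1, zero_smul])
    exact ⟨(i, 0), smul_zero _⟩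
  have hlen : ∀ x : M, Module.length R (Submodule.span R {x}) ≤ Module.length R R := fun x =>
    Module.length_le_of_surjective (LinearMap.toSpanSingleton R M x).rangeRestrict
      (LinearMap.surjective_rangeRestrict _) |>.trans' (by
        rw [LinearMap.range_toSpanSingleton])
  have hfin : Module.length R R ≠ ⊤ := Module.length_ne_top
  let S : Set ℕ :=
    {m | ∃ p : ι × M, e p.1 • p.2 = p.2 ∧ Module.length R (Submodule.span R {p.2}) = m}
  have hS : S.Nonempty := by
    obtain ⟨p, hp⟩ := hne
    obtain ⟨m, hm⟩ := ENat.ne_top_iff_exists.1 ((hlen p.2).trans_lt hfin.lt_top).ne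
    exact ⟨m, p, hp, hm.symm⟩
  have hbdd : BddAbove S := by
    obtain ⟨N, hN⟩ := ENat.ne_top_iff_exists.1 hfin
    refine ⟨N, ?_⟩
    rintro m ⟨p, -, hm⟩
    have := hlen p.2
    rw [hm, ← hN] at this
    exact_mod_cast this
  obtain ⟨⟨i, x⟩, hx, hm⟩ := Nat.sSup_mem hS hbdd
  refine ⟨i, x, hx, ?_⟩
  have hle : ∀ j (y : M), e j • y = y → Submodule.span R {y} ≤ Submodule.span R {x} := by
    intro j y hy
    refine (hM _ _).elim id fun h => ?_
    by_contra hyx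
    let P := (Submodule.span R {x}).comap (Submodule.span R {y}).subtype
    have hP : P ≠ ⊤ := fun hP => hyx (Submodule.comap_subtype_eq_top.1 hP)
    have hlt := Submodule.length_lt hP
    rw [(Submodule.comapSubtypeEquivOfLe h).length_eq] at hlt
    obtain ⟨m, hmy⟩ := ENat.ne_top_iff_exists.1 ((hlen y).trans_lt hfin.lt_top).ne
    have hmS : m ≤ sSup S := le_csSup hbdd ⟨(j, y), hy, hmy.symm⟩
    rw [hm, ← hmy] at hlt
    exact absurd hmS (by exact_mod_cast hlt.not_ge)
  rw [eq_top_iff]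
  intro y _
  rw [← one_smul R y, ← he.complete, Finset.sum_smul]
  exact Submodule.sum_mem _ fun j _ => hle j (e j • y)
    (by rw [smul_smul, he.idem j]) (Submodule.mem_span_singleton_self _)

/-- A ring has finite uniserial type if its uniserial modules are quotients by the members of a
finite set of left ideals. -/
theorem hasFiniteUniserialType_of_finite {R : Type*} [Ring R] {T : Set (Ideal R)} (hT : T.Finite)
    (h : ∀ M : ModuleCat.{w} R, IsUniserialModule R M → ∃ I ∈ T, Nonempty (M ≃ₗ[R] R ⧸ I)) :
    HasFiniteUniserialType.{w} R := by
  classical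
  choose! f hfT hf using h
  have key : ∀ c ∈ {c : Quotient (isIsomorphicSetoid (ModuleCat.{w} R)) |
      ∃ M : ModuleCat.{w} R, IsUniserialModule R M ∧
        Quotient.mk (isIsomorphicSetoid (ModuleCat.{w} R)) M = c},
      ∃ I ∈ T, ∃ M : ModuleCat.{w} R, Nonempty (M ≃ₗ[R] R ⧸ I) ∧
        Quotient.mk (isIsomorphicSetoid (ModuleCat.{w} R)) M = c := by
    rintro c ⟨M, hM, hc⟩
    exact ⟨f M, hfT M hM, M, hf M hM, hc⟩
  choose! G hG M hM hc using key
  refine Set.Finite.of_injOn (f := G) (t := T) (fun c hc => hG c hc) ?_ hT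
  intro c hcS d hdS hcd
  rw [← hc c hcS, ← hc d hdS]
  obtain ⟨φ⟩ := hM c hcS
  obtain ⟨ψ⟩ := hM d hdS
  rw [← hcd] at ψ
  exact Quotient.sound ⟨(φ.trans ψ.symm).toModuleIso⟩

/-- A left Artinian ring whose Peirce components are generated by each of their nonzero elements
has finite uniserial type. -/
theorem hasFiniteUniserialType_of_peirce {R ι : Type*} [Ring R] [IsArtinianRing R] [Fintype ι]
    {e : ι → R} (he : CompleteOrthogonalIdempotents e)
    (hR : ∀ k i y z, e k * y * e i ≠ 0 → ∃ r, e k * z * e i = r * (e k * y * e i)) :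
    HasFiniteUniserialType.{w} R := by
  refine hasFiniteUniserialType_of_finite (T := insert ⊤ (⋃ i, {I : Ideal R | 1 - e i ∈ I}))
    ((Set.finite_iUnion fun i => finite_setOf_one_sub_mem he i fun k => hR k i).insert _) ?_
  intro M hM
  rcases subsingleton_or_nontrivial M with hs | hs
  · have : Subsingleton (R ⧸ (⊤ : Ideal R)) := Submodule.Quotient.subsingleton_iff.2 rfl
    exact ⟨⊤, Set.mem_insert _ _, ⟨0⟩⟩
  · obtain ⟨i, x, hx, htop⟩ := hM.exists_span_singleton_eq_top he
    refine ⟨LinearMap.ker (LinearMap.toSpanSingleton R M x), Set.mem_insert_of_mem _ ?_,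
      ⟨(LinearMap.quotKerEquivOfSurjective _ ?_).symm⟩⟩
    · refine Set.mem_iUnion.2 ⟨i, ?_⟩
      simp [sub_smul, hx]
    · rw [← LinearMap.range_eq_top, LinearMap.range_toSpanSingleton, htop]

theorem Reduction.finite {D A : Type*} [CommRing D] [Ring A] [Algebra D A] [Module.Finite D A]
    (π : D) : Module.Finite (D ⧸ Ideal.span {π}) (Reduction A π) := by
  let f : A →ₛₗ[Ideal.Quotient.mk (Ideal.span {π})] Reduction A π :=
    { toFun := Ideal.Quotient.mk (centralIdeal A π)
      map_add' := map_add _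
      map_smul' := fun d a => by
        rw [Algebra.smul_def, map_mul, Algebra.smul_def]
        rfl }
  exact Module.Finite.of_surjective f Ideal.Quotient.mk_surjective

theorem corollary3p5 {D F : Type*} [CommRing D] [IsDomain D] [IsDiscreteValuationRing D]
    [Field F] [Algebra D F] [IsFractionRing D F]
    (π : D) (hπ : Irreducible π) (n : ℕ)
    (O : Subalgebra D (Matrix (Fin n) (Fin n) F)) (hO : IsTiledClassicalOrder O) :
    Module.Finite (D ⧸ Ideal.span {π}) (Reduction O π) ∧
      HasFiniteUniserialType.{w} (Reduction O π) := by
  obtain ⟨e, he, h0⟩ := hO.exists_idempotents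
  have := hO.finite
  have hfin : Module.Finite (D ⧸ Ideal.span {π}) (Reduction O π) := Reduction.finite π
  have : (Ideal.span {π}).IsMaximal :=
    hπ.maximalIdeal_eq ▸ IsLocalRing.maximalIdeal.isMaximal D
  let := Ideal.Quotient.field (Ideal.span {π})
  have : IsArtinianRing (Reduction O π) := IsArtinianRing.of_finite (D ⧸ Ideal.span {π}) _
  exact ⟨hfin, hasFiniteUniserialType_of_peirce (he.map (Ideal.Quotient.mk (centralIdeal O π)))
    (Reduction.exists_mul_eq_peirce hπ he.toOrthogonalIdempotents h0)⟩
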